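/- Let $\mathbb{C}\{x,y\}$ be the ring of convergent power series, and let $f\in\mathbb{C}\{x\}[y]$ be a Weierstrass polynomial of degree $n>1$ in $y$ that is irreducible in $\mathbb{C}\{x,y\}$. Let $(t^n,\varphi(t))$ be a primitive Puiseux parametrization of the branch $C_f:\ f=0$. That is, $\varphi=\sum_i a_it^i\in\mathbb{C}\{t\}$, $\varphi(0)=0$, $f(t^n,\varphi(t))=0$, and $n$ together with the exponents $i$ with $a_i\ne0$ have greatest common divisor $1$. Assume $m:=\operatorname{ord}_t\varphi>n$ and $n\nmid m$. For $h\in\mathbb{C}\{x,y\}$ put $\nu_f(h)=\operatorname{ord}_t h(t^n,\varphi(t))$. Put $\beta_0=e_0=n$ and, as long as $e_i\neq 1$, $$\beta_{i+1}=\min\{k:\ a_k\ne 0,\ e_i\nmid k\},\qquad e_{i+1}=\gcd(e_i,\beta_{i+1}).$$ Let $g$ be the first index with $e_g=1$. Put $n_0=1$, $n_i=e_{i-1}/e_i$ for $1\le i\le g$, and $$v_0=\beta_0=n,\qquad v_{i+1}=n_iv_i+\beta_{i+1}-\beta_i\quad(0\le i<g)$$ (these are the minimal generators of the value semigroup of $C_f$).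 Let $\omega=A\,dx-B\,dy\neq0$, where $A,B\in\mathbb{C}\{x\}[y]$, $\deg_yA<n$ and $\deg_yB<n-1$. Assume that $$Bf_x+Af_y=Mf\qquad\text{for some } M\in\mathbb{C}\{x,y\}$$ (equivalently, $\omega/f$ is a logarithmic form along $C_f$). Then $\nu_f(B)$, $\nu_f(M)$ and $\nu_f(f_y)$ are finite, $$\nu_f(B)=\nu_f(M)+v_0,$$ the set $\{i\in\{0,\dots,g\}:\ e_i\nmid \nu_f(B)-\nu_f(f_y)\}$ is non-empty, and if $k$ is its maximum and $$B(t^n,\varphi(t))=b\,t^{\nu_f(B)}+(\text{higher order terms}),\qquad b\ne 0,$$ then $$M(t^n,\varphi(t))=\frac{e_kv_{k+1}}{n}\,b\;t^{\nu_f(M)}+(\text{higher order terms}).$$ -/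

import Mathlib

namespace PlaneBranch

/-- A power series in finitely many variables over `ℂ` is convergent if it converges absolutely at
some point all of whose coordinates are equal to one positive real number. -/
def Converges {σ : Type} (h : MvPowerSeries σ ℂ) : Prop :=
  ∃ r : ℝ, 0 < r ∧ Summable fun m : σ →₀ ℕ => ‖MvPowerSeries.coeff m h‖ * r ^ m.degree

theorem Converges.common {σ : Type} {h k : MvPowerSeries σ ℂ} (hh : Converges h)
    (hk : Converges k) : ∃ r : ℝ, 0 < r ∧
      (Summable fun m : σ →₀ ℕ => ‖MvPowerSeries.coeff m h‖ * r ^ m.degree) ∧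
      Summable fun m : σ →₀ ℕ => ‖MvPowerSeries.coeff m k‖ * r ^ m.degree := by
  obtain ⟨r, hr, sr⟩ := hh
  obtain ⟨s, hs, ss⟩ := hk
  refine ⟨min r s, lt_min hr hs, ?_, ?_⟩
  · refine sr.of_nonneg_of_le (fun m => by positivity) fun m => ?_
    gcongr
    exact min_le_left r s
  · refine ss.of_nonneg_of_le (fun m => by positivity) fun m => ?_
    gcongr
    exact min_le_right r s

theorem Converges.add {σ : Type} {h k : MvPowerSeries σ ℂ} (hh : Converges h)
    (hk : Converges k) : Converges (h + k) := by
  obtain ⟨r, hr, h1, h2⟩ := hh.common hk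
  refine ⟨r, hr, (h1.add h2).of_nonneg_of_le (fun m => by positivity) fun m => ?_⟩
  rw [map_add, ← add_mul]
  gcongr
  exact norm_add_le _ _

theorem Converges.neg {σ : Type} {h : MvPowerSeries σ ℂ} (hh : Converges h) :
    Converges (-h) := by
  obtain ⟨r, hr, h1⟩ := hh
  exact ⟨r, hr, by simpa using h1⟩

theorem converges_C {σ : Type} (c : ℂ) :
    Converges (MvPowerSeries.C c : MvPowerSeries σ ℂ) := by
  classical
  refine ⟨1, one_pos, summable_of_ne_finset_zero (s := {0}) fun m hm => ?_⟩
  rw [Finset.mem_singleton] at hm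
  simp [MvPowerSeries.coeff_C, hm]

theorem Converges.mul {σ : Type} {h k : MvPowerSeries σ ℂ} (hh : Converges h)
    (hk : Converges k) : Converges (h * k) := by
  classical
  obtain ⟨r, hr, h1, h2⟩ := hh.common hk
  have hprod := Summable.mul_of_nonneg h1 h2 (fun m => by positivity) (fun m => by positivity)
  have key := summable_sum_mul_antidiagonal_of_summable_mul
    (f := fun m : σ →₀ ℕ => ‖MvPowerSeries.coeff m h‖ * r ^ m.degree)
    (g := fun m : σ →₀ ℕ => ‖MvPowerSeries.coeff m k‖ * r ^ m.degree) hprod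
  refine ⟨r, hr, Summable.of_nonneg_of_le (fun m => by positivity) (fun m => ?_) key⟩
  have h3 : ‖MvPowerSeries.coeff m (h * k)‖ ≤ ∑ p ∈ Finset.HasAntidiagonal.antidiagonal m,
      ‖MvPowerSeries.coeff p.1 h‖ * ‖MvPowerSeries.coeff p.2 k‖ := by
    rw [MvPowerSeries.coeff_mul]
    exact (norm_sum_le _ _).trans (le_of_eq (Finset.sum_congr rfl fun p _ => norm_mul _ _))
  refine (mul_le_mul_of_nonneg_right h3 (by positivity)).trans (le_of_eq ?_)
  rw [Finset.sum_mul]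
  refine Finset.sum_congr rfl fun p hp => ?_
  have h4 : m.degree = p.1.degree + p.2.degree := by
    rw [← Finset.HasAntidiagonal.mem_antidiagonal.1 hp, map_add]
  rw [h4, pow_add]
  ring

/-- The ring of convergent power series in the variables `σ` over `ℂ`. -/
def convergentSeries (σ : Type) : Subring (MvPowerSeries σ ℂ) where
  carrier := {h | Converges h}
  mul_mem' := Converges.mul
  one_mem' := by simpa using converges_C (σ := σ) 1
  add_mem' := Converges.add
  zero_mem' := by simpa using converges_C (σ := σ) 0
  neg_mem' := Converges.neg

/-- The ring `ℂ{x,y}`; the variable `x` has index `0` and the variable `y` has index `1`. -/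
abbrev Cxy : Type := convergentSeries (Fin 2)

/-- The partial derivative with respect to `x`. -/
noncomputable def dx (h : Cxy) : MvPowerSeries (Fin 2) ℂ :=
  MvPowerSeries.pderiv ℂ 0 (h : MvPowerSeries (Fin 2) ℂ)

/-- The partial derivative with respect to `y`. -/
noncomputable def dy (h : Cxy) : MvPowerSeries (Fin 2) ℂ :=
  MvPowerSeries.pderiv ℂ 1 (h : MvPowerSeries (Fin 2) ℂ)

/-- `P_s`: the elements of `ℂ{x}[y]` of degree less than `s` in `y`. -/
def polysDegLT (s : ℕ) : Set Cxy :=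
  {h | ∀ m : Fin 2 →₀ ℕ, s ≤ m 1 → MvPowerSeries.coeff m (h : MvPowerSeries (Fin 2) ℂ) = 0}

/-- `f = y ^ n + c₁(x) y ^ (n - 1) + ⋯ + cₙ(x)` is a Weierstrass polynomial of degree `n`:
all `cᵢ` belong to `ℂ{x}` and vanish at `0`. -/
def IsWeierstrass (n : ℕ) (f : Cxy) : Prop :=
  ∃ r ∈ polysDegLT n,
    (f : MvPowerSeries (Fin 2) ℂ) = MvPowerSeries.X 1 ^ n + (r : MvPowerSeries (Fin 2) ℂ) ∧
    ∀ j < n, MvPowerSeries.coeff (Finsupp.single 1 j) (r : MvPowerSeries (Fin 2) ℂ) = 0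

/-- The pull-back `h(t ^ n, φ(t))` of `h(x, y)`. -/
noncomputable def pullback (n : ℕ) (φ : PowerSeries ℂ) (h : MvPowerSeries (Fin 2) ℂ) :
    PowerSeries ℂ :=
  MvPowerSeries.subst ![(PowerSeries.X ^ n : PowerSeries ℂ), φ] h

/-- The value `ν_f(h)`, the order in `t` of `h(t ^ n, φ(t))`, where `(t ^ n, φ(t))` is a primitive
parametrization of the branch `f = 0`. -/
noncomputable def val (n : ℕ) (φ : PowerSeries ℂ) (h : MvPowerSeries (Fin 2) ℂ) : ℕ∞ :=
  (pullback n φ h).order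

/-- `(t ^ n, φ(t))` is a primitive Puiseux parametrization of the branch `f = 0`, where `φ` is a
convergent power series without constant term. -/
structure IsPrimitiveParam (n : ℕ) (f : Cxy) (φ : PowerSeries ℂ) : Prop where
  convergent : φ ∈ convergentSeries Unit
  constantCoeff : PowerSeries.constantCoeff φ = 0
  vanishes : pullback n φ f = 0
  primitive : ∀ d : ℕ, d ∣ n → (∀ i, PowerSeries.coeff i φ ≠ 0 → d ∣ i) → d = 1

/-- The pairs `(β_i, e_i)`: `β_0 = e_0 = n`, and
`β_{i+1} = min {k | a_k ≠ 0, e_i ∤ k}`, `e_{i+1} = gcd (e_i, β_{i+1})`,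
where `φ = ∑ a_k t ^ k`. (Once `e_i = 1` the minimum is over the empty set; these further terms
have no meaning.) -/
noncomputable def charPair (n : ℕ) (φ : PowerSeries ℂ) : ℕ → ℕ × ℕ
  | 0 => (n, n)
  | i + 1 =>
    let e := (charPair n φ i).2
    let b := sInf {k : ℕ | PowerSeries.coeff k φ ≠ 0 ∧ ¬ e ∣ k}
    (b, Nat.gcd e b)

/-- The characteristic exponents `β_i`. -/
noncomputable def charExp (n : ℕ) (φ : PowerSeries ℂ) (i : ℕ) : ℕ := (charPair n φ i).1

/-- The greatest common divisors `e_i = gcd (β_0, …, β_i)`. -/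
noncomputable def charGcd (n : ℕ) (φ : PowerSeries ℂ) (i : ℕ) : ℕ := (charPair n φ i).2

/-- The number `g` of characteristic exponents after `β_0`: the first index with `e_g = 1`. -/
noncomputable def charLength (n : ℕ) (φ : PowerSeries ℂ) : ℕ := sInf {i | charGcd n φ i = 1}

/-- `n_0 = 1` and `n_i = e_{i-1} / e_i` for `i ≥ 1`. -/
noncomputable def charQuot (n : ℕ) (φ : PowerSeries ℂ) : ℕ → ℕ
  | 0 => 1
  | i + 1 => charGcd n φ i / charGcd n φ (i + 1)

/-- The generators `v_0, …, v_g` of the value semigroup: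
`v_0 = β_0` and `v_{i+1} = n_i v_i + β_{i+1} - β_i` for `0 ≤ i < g`. -/
noncomputable def semigroupGen (n : ℕ) (φ : PowerSeries ℂ) : ℕ → ℤ
  | 0 => charExp n φ 0
  | i + 1 => charQuot n φ i * semigroupGen n φ i + charExp n φ (i + 1) - charExp n φ i

end PlaneBranch

open PlaneBranch

/-! Let `ζ` be a primitive `n`-th root of unity and `φ_j(t) = φ(ζ^j t)`. By primitivity these are
distinct, so `f(t^n, Y) = ∏ (Y - φ_j)` (`yPoly_eq_nodal`). Write `b`, `V`, `p` for the pull-backs of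
`B`, `f_y`, `M`, and `b_j`, `V_j` for their conjugates under `t ↦ ζ^j t`; then `V = ∏_{j≠0} (φ -
φ_j)`.

Restricting the equation for `M` and its `y`-derivative to the branch expresses `p` through `b`,
`V'` and the values of `A_y`, `B_y` (`pullback_form`, `pullback_cofactor`). Lagrange interpolation
at the `φ_j` removes `A_y` and `B_y`, leaving (`cofactor_expansion`) `n t^n p = V ∑_j (b/V -
b_j/V_j) · t(φ - φ_j)'/(φ - φ_j)`.

With `s = ν_f(B) - ν_f(f_y)` and `b/V = c t^s + ⋯`, one has `b_j/V_j = ζ^{sj} c t^s + ⋯`, while the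
logarithmic derivative starts with the contact order of `φ` and `φ_j`. So the leading coefficient of
the sum is `c ∑_j (1 - ζ^{sj}) ord(φ - φ_j)`. The contact orders are characteristic exponents,
constant on the layers of a chain of subgroups of `ℤ/n`; orthogonality of characters and the
recursion for `v_i` evaluate the sum as `e_k v_{k+1}` (`sum_one_sub_mul_order`). This is nonzero, so
it determines both the order and the leading coefficient of `p`. That `k` exists follows from `∑
b_j/V_j = 0`, Euler's identity for `deg B < n - 1`, which forces `n ∤ s`. -/

namespace PlaneBranch

open PowerSeries (expand rescale derivative)

/-! ### Pull-backs of polynomials in `y` -/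

/-- `h` is a polynomial of degree less than `s` in `y`. -/
def YDegLT (s : ℕ) (h : MvPowerSeries (Fin 2) ℂ) : Prop :=
  ∀ m : Fin 2 →₀ ℕ, s ≤ m 1 → MvPowerSeries.coeff m h = 0

/-- A power series in `x`, as a power series in `x` and `y`. -/
noncomputable def inX (c : PowerSeries ℂ) : MvPowerSeries (Fin 2) ℂ :=
  PowerSeries.subst (MvPowerSeries.X 0 : MvPowerSeries (Fin 2) ℂ) c

/-- The coefficient of `y ^ j` in `h`, as a power series in `x`. -/
noncomputable def yCoeff (j : ℕ) (h : MvPowerSeries (Fin 2) ℂ) : PowerSeries ℂ :=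
  PowerSeries.mk fun i => MvPowerSeries.coeff (Finsupp.single 0 i + Finsupp.single 1 j) h

theorem coeff_inX (c : PowerSeries ℂ) (m : Fin 2 →₀ ℕ) :
    MvPowerSeries.coeff m (inX c) = if m 1 = 0 then PowerSeries.coeff (m 0) c else 0 := by
  rw [inX, PowerSeries.coeff_subst_single]
  congr 1
  simp [Finsupp.ext_iff, Fin.forall_fin_two]

theorem coeff_inX_mul_X_pow (c : PowerSeries ℂ) (j : ℕ) (m : Fin 2 →₀ ℕ) :
    MvPowerSeries.coeff m (inX c * MvPowerSeries.X 1 ^ j) =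
      if m 1 = j then PowerSeries.coeff (m 0) c else 0 := by
  rw [MvPowerSeries.X_pow_eq, MvPowerSeries.coeff_mul_monomial, coeff_inX]
  by_cases h : j ≤ m 1
  · have h1 : Finsupp.single 1 j ≤ m := by simpa using h
    rw [if_pos h1]
    simp only [Finsupp.coe_tsub, Pi.sub_apply, Finsupp.single_eq_same, mul_one]
    have h2 : (m 1 - j = 0) ↔ m 1 = j := by omega
    simp [h2]
  · have h1 : ¬ Finsupp.single 1 j ≤ m := by simpa using h
    rw [if_neg h1, if_neg (by omega)]

/-- Reduces identities for pull-backs to terms `c(x) y^j`, so that only finite sums have to be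
differentiated or evaluated. -/
theorem YDegLT.eq_sum {s : ℕ} {h : MvPowerSeries (Fin 2) ℂ} (hh : YDegLT s h) :
    h = ∑ j ∈ Finset.range s, inX (yCoeff j h) * MvPowerSeries.X 1 ^ j := by
  ext m
  simp only [map_sum, coeff_inX_mul_X_pow]
  by_cases hm : s ≤ m 1
  · rw [hh m hm, Finset.sum_eq_zero]
    intro j hj
    rw [if_neg]
    have := Finset.mem_range.1 hj
    omega
  · rw [Finset.sum_ite_eq, if_pos (Finset.mem_range.2 (by omega)), yCoeff, PowerSeries.coeff_mk]
    congr 1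
    congr 1
    ext i
    fin_cases i <;> simp

theorem YDegLT.pderiv_one {s : ℕ} {h : MvPowerSeries (Fin 2) ℂ} (hh : YDegLT s h) :
    YDegLT s (MvPowerSeries.pderiv ℂ 1 h) := by
  intro m hm
  rw [MvPowerSeries.coeff_pderiv, hh _ (by simp; omega), zero_mul]

theorem pderiv_zero_inX (c : PowerSeries ℂ) :
    MvPowerSeries.pderiv ℂ 0 (inX c) = inX (derivative ℂ c) := by
  ext m
  simp [MvPowerSeries.coeff_pderiv, coeff_inX, PowerSeries.coeff_derivative]

theorem pderiv_one_inX (c : PowerSeries ℂ) :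
    MvPowerSeries.pderiv ℂ 1 (inX c) = 0 := by
  ext m
  simp [MvPowerSeries.coeff_pderiv, coeff_inX]

theorem pderiv_comm (h : MvPowerSeries (Fin 2) ℂ) :
    MvPowerSeries.pderiv ℂ 1 (MvPowerSeries.pderiv ℂ 0 h) =
      MvPowerSeries.pderiv ℂ 0 (MvPowerSeries.pderiv ℂ 1 h) := by
  ext m
  simp only [MvPowerSeries.coeff_pderiv, Finsupp.add_apply]
  rw [add_right_comm]
  simp
  ring

/-! ### The pull-back homomorphism and the polynomial `h(t^n, Y)` -/

section

variable {n : ℕ} {φ : PowerSeries ℂ}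

theorem hasSubst_param (hn : n ≠ 0) (hφ : PowerSeries.constantCoeff φ = 0) :
    MvPowerSeries.HasSubst ![(PowerSeries.X ^ n : PowerSeries ℂ), φ] := by
  apply MvPowerSeries.hasSubst_of_constantCoeff_zero
  intro i
  fin_cases i
  · exact (by simp [hn] : PowerSeries.constantCoeff (PowerSeries.X ^ n : PowerSeries ℂ) = 0)
  · exact hφ

/-- The pull-back as a ring homomorphism. -/
noncomputable def pullbackHom (hn : n ≠ 0) (hφ : PowerSeries.constantCoeff φ = 0) :
    MvPowerSeries (Fin 2) ℂ →ₐ[ℂ] PowerSeries ℂ :=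
  MvPowerSeries.substAlgHom (hasSubst_param hn hφ)

theorem pullbackHom_apply (hn : n ≠ 0) (hφ : PowerSeries.constantCoeff φ = 0)
    (h : MvPowerSeries (Fin 2) ℂ) : pullbackHom hn hφ h = pullback n φ h := by
  rw [pullbackHom, MvPowerSeries.substAlgHom_apply, pullback]

theorem pullbackHom_X_one (hn : n ≠ 0) (hφ : PowerSeries.constantCoeff φ = 0) :
    pullbackHom hn hφ (MvPowerSeries.X 1) = φ := by
  rw [pullbackHom, MvPowerSeries.substAlgHom_X]
  rfl

theorem pullbackHom_inX (hn : n ≠ 0) (hφ : PowerSeries.constantCoeff φ = 0) (c : PowerSeries ℂ) :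
    pullbackHom hn hφ (inX c) = expand n hn c := by
  have h1 : MvPowerSeries.HasSubst (fun _ : Unit => (MvPowerSeries.X 0 : MvPowerSeries (Fin 2) ℂ)) :=
    (PowerSeries.HasSubst.X 0).const
  rw [pullbackHom, MvPowerSeries.substAlgHom_apply, inX, PowerSeries.subst,
    MvPowerSeries.subst_comp_subst_apply h1 (hasSubst_param hn hφ), PowerSeries.expand_apply,
    PowerSeries.subst]
  congr 1
  funext _
  rw [MvPowerSeries.subst_X (hasSubst_param hn hφ)]
  rfl

theorem derivative_expand (hn : n ≠ 0) (c : PowerSeries ℂ) :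
    derivative ℂ (expand n hn c) =
      (n : PowerSeries ℂ) * PowerSeries.X ^ (n - 1) * expand n hn (derivative ℂ c) := by
  rw [PowerSeries.expand_apply, PowerSeries.derivative_subst (PowerSeries.HasSubst.X_pow hn),
    PowerSeries.derivative_pow, PowerSeries.derivative_X, ← PowerSeries.expand_apply n hn]
  ring

/-- The chain rule for the pull-back of a polynomial in `y`. -/
theorem derivative_pullbackHom (hn : n ≠ 0) (hφ : PowerSeries.constantCoeff φ = 0) {s : ℕ}
    {h : MvPowerSeries (Fin 2) ℂ} (hh : YDegLT s h) :
    derivative ℂ (pullbackHom hn hφ h) =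
      (n : PowerSeries ℂ) * PowerSeries.X ^ (n - 1) * pullbackHom hn hφ (MvPowerSeries.pderiv ℂ 0 h) +
        derivative ℂ φ * pullbackHom hn hφ (MvPowerSeries.pderiv ℂ 1 h) := by
  conv_lhs => rw [hh.eq_sum]
  conv_rhs => rw [hh.eq_sum]
  simp only [map_sum, Finset.mul_sum, ← Finset.sum_add_distrib]
  refine Finset.sum_congr rfl fun j _ => ?_
  simp only [Derivation.leibniz, smul_eq_mul, map_mul, map_add, pderiv_zero_inX, pderiv_one_inX,
    MvPowerSeries.pderiv_pow, map_pow, pullbackHom_X_one, pullbackHom_inX, derivative_expand,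
    MvPowerSeries.pderiv_X_self, PowerSeries.derivative_pow, map_natCast, mul_one, mul_zero,
    MvPowerSeries.pderiv_X_of_ne (show (1 : Fin 2) ≠ 0 by decide), map_zero]
  ring

/-- The polynomial `h(t ^ n, Y)` over `ℂ⟦t⟧`, for `h` of degree less than `s` in `y`. -/
noncomputable def yPoly (hn : n ≠ 0) (s : ℕ) (h : MvPowerSeries (Fin 2) ℂ) :
    Polynomial (PowerSeries ℂ) :=
  ∑ j ∈ Finset.range s, Polynomial.C (expand n hn (yCoeff j h)) * Polynomial.X ^ j

theorem coeff_yPoly (hn : n ≠ 0) (s : ℕ) (h : MvPowerSeries (Fin 2) ℂ) (j : ℕ) :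
    (yPoly hn s h).coeff j = if j < s then expand n hn (yCoeff j h) else 0 := by
  simp [yPoly, Polynomial.finsetSum_coeff]

theorem degree_yPoly_lt (hn : n ≠ 0) (s : ℕ) (h : MvPowerSeries (Fin 2) ℂ) :
    (yPoly hn s h).degree < s := by
  rw [Polynomial.degree_lt_iff_coeff_zero]
  intro j hj
  rw [coeff_yPoly, if_neg (by omega)]

theorem eval_yPoly (hn : n ≠ 0) (hφ : PowerSeries.constantCoeff φ = 0) {s : ℕ}
    {h : MvPowerSeries (Fin 2) ℂ} (hh : YDegLT s h) :
    (yPoly hn s h).eval φ = pullbackHom hn hφ h := by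
  conv_rhs => rw [hh.eq_sum]
  simp [yPoly, Polynomial.eval_finsetSum, pullbackHom_inX, pullbackHom_X_one]

theorem eval_derivative_yPoly (hn : n ≠ 0) (hφ : PowerSeries.constantCoeff φ = 0) {s : ℕ}
    {h : MvPowerSeries (Fin 2) ℂ} (hh : YDegLT s h) :
    (Polynomial.derivative (yPoly hn s h)).eval φ =
      pullbackHom hn hφ (MvPowerSeries.pderiv ℂ 1 h) := by
  conv_rhs => rw [hh.eq_sum]
  simp only [yPoly, map_sum, Polynomial.eval_finsetSum]
  refine Finset.sum_congr rfl fun j _ => ?_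
  simp only [Derivation.leibniz, smul_eq_mul, map_mul, pderiv_one_inX, Polynomial.eval_natCast,
    MvPowerSeries.pderiv_pow, map_pow, pullbackHom_X_one, pullbackHom_inX,
    MvPowerSeries.pderiv_X_self, map_natCast, mul_one, mul_zero, add_zero,
    Polynomial.derivative_C_mul, Polynomial.derivative_X_pow, Polynomial.eval_mul,
    Polynomial.eval_C, Polynomial.eval_pow, Polynomial.eval_X]

theorem rescale_expand (hn : n ≠ 0) {a : ℂ} (ha : a ^ n = 1) (c : PowerSeries ℂ) :
    rescale a (expand n hn c) = expand n hn c := by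
  ext k
  rw [PowerSeries.coeff_rescale, PowerSeries.coeff_expand]
  split_ifs with h
  · obtain ⟨q, rfl⟩ := h
    rw [pow_mul, ha, one_pow, one_mul]
  · rw [mul_zero]

theorem map_rescale_yPoly (hn : n ≠ 0) {a : ℂ} (ha : a ^ n = 1) (s : ℕ)
    (h : MvPowerSeries (Fin 2) ℂ) : (yPoly hn s h).map (rescale a) = yPoly hn s h := by
  simp [yPoly, Polynomial.map_sum, rescale_expand hn ha]

/-- The coefficients are series in `t^n`, hence fixed by `t ↦ a t`; values at a conjugate of `φ` are
therefore conjugates of the value at `φ`. -/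
theorem eval_rescale_yPoly (hn : n ≠ 0) {a : ℂ} (ha : a ^ n = 1) (s : ℕ)
    (h : MvPowerSeries (Fin 2) ℂ) :
    (yPoly hn s h).eval (rescale a φ) = rescale a ((yPoly hn s h).eval φ) := by
  conv_lhs => rw [← map_rescale_yPoly hn ha s h]
  rw [Polynomial.eval_map, Polynomial.eval₂_hom]

theorem eval_rescale_derivative_yPoly (hn : n ≠ 0) {a : ℂ} (ha : a ^ n = 1) (s : ℕ)
    (h : MvPowerSeries (Fin 2) ℂ) :
    (Polynomial.derivative (yPoly hn s h)).eval (rescale a φ) =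
      rescale a ((Polynomial.derivative (yPoly hn s h)).eval φ) := by
  conv_lhs => rw [← map_rescale_yPoly hn ha s h]
  rw [Polynomial.derivative_map, Polynomial.eval_map, Polynomial.eval₂_hom]

theorem eq_zero_of_yPoly_eq_zero (hn : n ≠ 0) {s : ℕ} {h : MvPowerSeries (Fin 2) ℂ}
    (hh : YDegLT s h) (h0 : yPoly hn s h = 0) : h = 0 := by
  rw [hh.eq_sum]
  refine Finset.sum_eq_zero fun j hj => ?_
  have h1 := coeff_yPoly hn s h j
  rw [h0, Polynomial.coeff_zero, if_pos (Finset.mem_range.1 hj)] at h1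
  have h2 : yCoeff j h = 0 := by
    ext i
    rw [← PowerSeries.coeff_expand_mul n hn, ← h1, map_zero, map_zero]
  have h3 : inX 0 = 0 := by
    ext m
    simp [coeff_inX]
  rw [h2, h3, zero_mul]

theorem IsWeierstrass.yDegLT {f : Cxy} (hf : IsWeierstrass n f) :
    YDegLT (n + 1) (f : MvPowerSeries (Fin 2) ℂ) := by
  classical
  obtain ⟨r, hr, hfr, -⟩ := hf
  intro m hm
  rw [hfr, map_add, hr m (by omega), add_zero, MvPowerSeries.coeff_X_pow, if_neg]
  rintro rfl
  simp at hm

theorem IsWeierstrass.coeff_yPoly_self {f : Cxy} (hf : IsWeierstrass n f) (hn : n ≠ 0) :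
    (yPoly hn (n + 1) (f : MvPowerSeries (Fin 2) ℂ)).coeff n = 1 := by
  classical
  obtain ⟨r, hr, hfr, -⟩ := hf
  rw [coeff_yPoly, if_pos (Nat.lt_succ_self n)]
  have : yCoeff n (f : MvPowerSeries (Fin 2) ℂ) = 1 := by
    ext i
    rw [yCoeff, PowerSeries.coeff_mk, hfr, map_add, hr _ (by simp), MvPowerSeries.coeff_X_pow,
      PowerSeries.coeff_one]
    simp [Finsupp.ext_iff, Fin.forall_fin_two]
  rw [this, map_one]

theorem IsWeierstrass.degree_yPoly {f : Cxy} (hf : IsWeierstrass n f) (hn : n ≠ 0) :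
    (yPoly hn (n + 1) (f : MvPowerSeries (Fin 2) ℂ)).degree = n := by
  refine le_antisymm (Polynomial.degree_le_iff_coeff_zero _ _ |>.2 fun j hj => ?_)
    (Polynomial.le_degree_of_ne_zero ?_)
  · rw [coeff_yPoly, if_neg]
    have := Nat.cast_lt.1 hj
    omega
  · rw [hf.coeff_yPoly_self hn]
    exact one_ne_zero

theorem IsWeierstrass.monic_yPoly {f : Cxy} (hf : IsWeierstrass n f) (hn : n ≠ 0) :
    (yPoly hn (n + 1) (f : MvPowerSeries (Fin 2) ℂ)).Monic :=
  Polynomial.monic_of_degree_le n (hf.degree_yPoly hn).le (hf.coeff_yPoly_self hn)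

end

end PlaneBranch

namespace PlaneBranch

open PowerSeries (rescale derivative)

/-! ### Leading terms of Laurent series -/

/-- The field of formal Laurent series, as the fraction field of `ℂ⟦t⟧`. -/
abbrev Lau : Type := FractionRing (PowerSeries ℂ)

/-- The inclusion of `ℂ⟦t⟧` in its fraction field. -/
noncomputable abbrev toLau : PowerSeries ℂ →+* Lau := algebraMap (PowerSeries ℂ) Lau

theorem toLau_injective : Function.Injective toLau :=
  IsFractionRing.injective (PowerSeries ℂ) Lau

theorem toLau_X_ne_zero : toLau PowerSeries.X ≠ 0 :=
  (map_ne_zero_iff _ toLau_injective).2 PowerSeries.X_ne_zero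

/-- `u = c t ^ s + (higher order terms)`, where `c = 0` is allowed. -/
def HasLead (u : Lau) (s : ℤ) (c : ℂ) : Prop :=
  ∃ r : PowerSeries ℂ, u = toLau PowerSeries.X ^ s * toLau r ∧ PowerSeries.constantCoeff r = c

theorem HasLead.add {u v : Lau} {s : ℤ} {c d : ℂ} (hu : HasLead u s c) (hv : HasLead v s d) :
    HasLead (u + v) s (c + d) := by
  obtain ⟨r, rfl, rfl⟩ := hu
  obtain ⟨q, rfl, rfl⟩ := hv
  exact ⟨r + q, by rw [map_add, mul_add], map_add _ _ _⟩

theorem HasLead.sub {u v : Lau} {s : ℤ} {c d : ℂ} (hu : HasLead u s c) (hv : HasLead v s d) :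
    HasLead (u - v) s (c - d) := by
  obtain ⟨r, rfl, rfl⟩ := hu
  obtain ⟨q, rfl, rfl⟩ := hv
  exact ⟨r - q, by rw [map_sub, mul_sub], map_sub _ _ _⟩

theorem HasLead.mul {u v : Lau} {s s' : ℤ} {c d : ℂ} (hu : HasLead u s c) (hv : HasLead v s' d) :
    HasLead (u * v) (s + s') (c * d) := by
  obtain ⟨r, rfl, rfl⟩ := hu
  obtain ⟨q, rfl, rfl⟩ := hv
  exact ⟨r * q, by rw [map_mul, zpow_add₀ toLau_X_ne_zero]; ring, map_mul _ _ _⟩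

theorem HasLead.inv {u : Lau} {s : ℤ} {c : ℂ} (hu : HasLead u s c) (hc : c ≠ 0) :
    HasLead u⁻¹ (-s) c⁻¹ := by
  obtain ⟨r, rfl, rfl⟩ := hu
  refine ⟨r⁻¹, ?_, PowerSeries.constantCoeff_inv r⟩
  rw [mul_inv, zpow_neg]
  congr 1
  refine inv_eq_of_mul_eq_one_right ?_
  rw [← map_mul, PowerSeries.mul_inv_cancel _ hc, map_one]

theorem HasLead.div {u v : Lau} {s s' : ℤ} {c d : ℂ} (hu : HasLead u s c) (hv : HasLead v s' d)
    (hd : d ≠ 0) : HasLead (u / v) (s - s') (c / d) := by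
  rw [div_eq_mul_inv, div_eq_mul_inv, sub_eq_add_neg]
  exact hu.mul (hv.inv hd)

/-- Since zero leading coefficients are allowed, cancellation needs no discussion here; nonvanishing
matters only for inverses and in `HasLead.of_toLau`. -/
theorem HasLead.sum {ι : Type*} {S : Finset ι} {u : ι → Lau} {s : ℤ} {c : ι → ℂ}
    (hu : ∀ i ∈ S, HasLead (u i) s (c i)) : HasLead (∑ i ∈ S, u i) s (∑ i ∈ S, c i) := by
  classical
  induction S using Finset.induction_on with
  | empty => exact ⟨0, by simp, by simp⟩
  | insert i S hi ih =>
    rw [Finset.sum_insert hi, Finset.sum_insert hi]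
    exact (hu i (Finset.mem_insert_self i S)).add
      (ih fun j hj => hu j (Finset.mem_insert_of_mem hj))

theorem HasLead.eq_zero {s : ℤ} {c : ℂ} (h : HasLead 0 s c) : c = 0 := by
  obtain ⟨r, h0, rfl⟩ := h
  have h1 : toLau r = 0 := (mul_eq_zero.1 h0.symm).resolve_left (zpow_ne_zero _ toLau_X_ne_zero)
  rw [(map_eq_zero_iff _ toLau_injective).1 h1, map_zero]

theorem order_X_pow_mul {r : PowerSeries ℂ} (hr : PowerSeries.constantCoeff r ≠ 0) (k : ℕ) :
    (PowerSeries.X ^ k * r).order = (k : ℕ∞) := by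
  rw [PowerSeries.order_mul, PowerSeries.order_X_pow, PowerSeries.order_zero_of_unit, add_zero]
  rw [PowerSeries.isUnit_iff_constantCoeff]
  exact hr.isUnit

theorem exists_eq_X_pow_mul {p : PowerSeries ℂ} {k : ℕ} (hp : p.order = k) :
    ∃ r : PowerSeries ℂ, p = PowerSeries.X ^ k * r ∧
      PowerSeries.constantCoeff r = PowerSeries.coeff k p ∧ PowerSeries.coeff k p ≠ 0 := by
  obtain ⟨r, hr⟩ : PowerSeries.X ^ k ∣ p :=
    PowerSeries.X_pow_dvd_iff.2 fun m hm => PowerSeries.coeff_of_lt_order m (by rw [hp]; exact_mod_cast hm)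
  refine ⟨r, hr, ?_, (PowerSeries.order_eq_nat.1 hp).1⟩
  have := PowerSeries.coeff_X_pow_mul r k 0
  rw [zero_add, ← hr] at this
  rw [this, PowerSeries.coeff_zero_eq_constantCoeff_apply]

theorem hasLead_toLau {p : PowerSeries ℂ} {k : ℕ} (hp : p.order = k) :
    HasLead (toLau p) k (PowerSeries.coeff k p) := by
  obtain ⟨r, hr, h1, -⟩ := exists_eq_X_pow_mul hp
  refine ⟨r, ?_, h1⟩
  conv_lhs => rw [hr]
  simp

theorem hasLead_toLau_rescale {p : PowerSeries ℂ} {k : ℕ} (hp : p.order = k) (a : ℂ) :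
    HasLead (toLau (rescale a p)) k (a ^ k * PowerSeries.coeff k p) := by
  obtain ⟨r, hr, h1, -⟩ := exists_eq_X_pow_mul hp
  refine ⟨PowerSeries.C (a ^ k) * rescale a r, ?_, ?_⟩
  · conv_lhs => rw [hr]
    rw [map_mul, map_pow, PowerSeries.rescale_X, mul_pow, ← map_pow]
    simp only [map_mul, map_pow, zpow_natCast]
    ring
  · rw [map_mul, PowerSeries.constantCoeff_C, ← PowerSeries.coeff_zero_eq_constantCoeff_apply,
      PowerSeries.coeff_rescale, pow_zero, one_mul, PowerSeries.coeff_zero_eq_constantCoeff_apply,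
      h1]

theorem HasLead.of_toLau {p : PowerSeries ℂ} {k : ℕ} {c : ℂ} (h : HasLead (toLau p) k c)
    (hc : c ≠ 0) : p.order = k ∧ PowerSeries.coeff k p = c := by
  obtain ⟨r, hr, rfl⟩ := h
  have h1 : p = PowerSeries.X ^ k * r := by
    apply toLau_injective
    rw [hr, map_mul, map_pow, zpow_natCast]
  refine ⟨by rw [h1, order_X_pow_mul hc], ?_⟩
  have := PowerSeries.coeff_X_pow_mul r k 0
  rw [zero_add, ← h1] at this
  rw [this, PowerSeries.coeff_zero_eq_constantCoeff_apply]

/-- The leading term of the logarithmic derivative `t u' / u`. -/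
theorem hasLead_logDeriv {p : PowerSeries ℂ} {k : ℕ} (hp : p.order = k) :
    HasLead (toLau (PowerSeries.X * derivative ℂ p) / toLau p) 0 k := by
  obtain ⟨r, hr, h1, h2⟩ := exists_eq_X_pow_mul hp
  have h3 : HasLead (toLau (PowerSeries.X * derivative ℂ p)) k (k * PowerSeries.coeff k p) := by
    refine ⟨(k : PowerSeries ℂ) * r + PowerSeries.X * derivative ℂ r, ?_, ?_⟩
    · rw [zpow_natCast, ← map_pow, ← map_mul]
      congr 1
      conv_lhs => rw [hr]
      rw [Derivation.leibniz, PowerSeries.derivative_pow, PowerSeries.derivative_X]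
      rcases k with _ | k
      · simp
      · simp only [smul_eq_mul, Nat.add_sub_cancel]
        ring
    · simp [h1]
  have h4 := h3.div (hasLead_toLau hp) h2
  rwa [sub_self, mul_div_cancel_right₀ _ h2] at h4

end PlaneBranch

namespace PlaneBranch

open PowerSeries (rescale derivative)

/-! ### Characteristic exponents and conjugate parametrizations -/

section

variable {n : ℕ} {φ : PowerSeries ℂ}

theorem charGcd_succ (i : ℕ) :
    charGcd n φ (i + 1) = Nat.gcd (charGcd n φ i) (charExp n φ (i + 1)) := rfl

theorem semigroupGen_succ (i : ℕ) : semigroupGen n φ (i + 1) =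
    charQuot n φ i * semigroupGen n φ i + charExp n φ (i + 1) - charExp n φ i := rfl

theorem charGcd_succ_dvd (i : ℕ) : charGcd n φ (i + 1) ∣ charGcd n φ i :=
  Nat.gcd_dvd_left _ _

theorem charGcd_dvd_of_le {i j : ℕ} (h : i ≤ j) : charGcd n φ j ∣ charGcd n φ i := by
  induction j, h using Nat.le_induction with
  | base => exact dvd_rfl
  | succ j _ ih => exact (charGcd_succ_dvd j).trans ih

theorem charGcd_dvd (i : ℕ) : charGcd n φ i ∣ n := charGcd_dvd_of_le (Nat.zero_le i)

theorem charGcd_pos (hn : 0 < n) (i : ℕ) : 0 < charGcd n φ i :=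
  Nat.pos_of_dvd_of_pos (charGcd_dvd i) hn

theorem charGcd_ne_one_of_succ {i : ℕ} (h : charGcd n φ (i + 1) ≠ 1) : charGcd n φ i ≠ 1 :=
  fun h1 => h (Nat.dvd_one.1 ((charGcd_succ_dvd i).trans h1.dvd))

theorem charGcd_dvd_of_lt_charExp {i k : ℕ} (hk : k < charExp n φ (i + 1))
    (h0 : PowerSeries.coeff k φ ≠ 0) : charGcd n φ i ∣ k := by
  by_contra h
  exact Nat.notMem_of_lt_sInf hk ⟨h0, h⟩

/-- If `e_i` divided every exponent of `φ`, primitivity would give `e_i = 1`; so the minimum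
defining `β_{i+1}` is over a nonempty set. -/
theorem charExp_succ_spec (hp : ∀ d : ℕ, d ∣ n → (∀ i, PowerSeries.coeff i φ ≠ 0 → d ∣ i) → d = 1)
    {i : ℕ} (hi : charGcd n φ i ≠ 1) :
    PowerSeries.coeff (charExp n φ (i + 1)) φ ≠ 0 ∧ ¬ charGcd n φ i ∣ charExp n φ (i + 1) := by
  have : {k : ℕ | PowerSeries.coeff k φ ≠ 0 ∧ ¬ charGcd n φ i ∣ k}.Nonempty := by
    by_contra h
    rw [Set.not_nonempty_iff_eq_empty, Set.eq_empty_iff_forall_notMem] at h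
    refine hi (hp _ (charGcd_dvd i) fun k hk => ?_)
    by_contra h1
    exact h k ⟨hk, h1⟩
  exact Nat.sInf_mem this

/-- As long as `e_i ≠ 1` the next gcd is strictly smaller, which cannot go on for `n` steps. -/
theorem exists_charGcd_eq_one (hn : 0 < n)
    (hp : ∀ d : ℕ, d ∣ n → (∀ i, PowerSeries.coeff i φ ≠ 0 → d ∣ i) → d = 1) :
    ∃ i, charGcd n φ i = 1 := by
  by_contra! h
  have key : ∀ i, charGcd n φ i + i ≤ n := by
    intro i
    induction i with
    | zero => exact le_rfl
    | succ i ih =>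
      have h1 : charGcd n φ (i + 1) ≠ charGcd n φ i := fun h2 =>
        (charExp_succ_spec hp (h i)).2 (h2 ▸ Nat.gcd_dvd_right _ _)
      have h2 := Nat.le_of_dvd (charGcd_pos hn i) (charGcd_succ_dvd (φ := φ) i)
      omega
  have := key n
  have := charGcd_pos (φ := φ) hn n
  omega

theorem charGcd_charLength (hn : 0 < n)
    (hp : ∀ d : ℕ, d ∣ n → (∀ i, PowerSeries.coeff i φ ≠ 0 → d ∣ i) → d = 1) :
    charGcd n φ (charLength n φ) = 1 :=
  Nat.sInf_mem (s := {i | charGcd n φ i = 1}) (exists_charGcd_eq_one hn hp)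

theorem charExp_succ_le (hp : ∀ d : ℕ, d ∣ n → (∀ i, PowerSeries.coeff i φ ≠ 0 → d ∣ i) → d = 1)
    {i : ℕ} (hi : charGcd n φ (i + 1) ≠ 1) : charExp n φ (i + 1) ≤ charExp n φ (i + 2) := by
  obtain ⟨h1, h2⟩ := charExp_succ_spec hp hi
  exact Nat.sInf_le ⟨h1, fun h => h2 ((charGcd_succ_dvd i).trans h)⟩

theorem charGcd_mul_charQuot (i : ℕ) :
    charGcd n φ (i + 1) * charQuot n φ (i + 1) = charGcd n φ i :=
  Nat.mul_div_cancel' (charGcd_succ_dvd i)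

theorem semigroupGen_one : semigroupGen n φ 1 = charExp n φ 1 := by
  simp [semigroupGen, charQuot]

/-- The recursion for `v_{i+2}` multiplied by `e_{i+1}`: in this form it telescopes against the sum
of contact orders. -/
theorem charGcd_mul_semigroupGen (i : ℕ) :
    (charGcd n φ (i + 1) : ℤ) * semigroupGen n φ (i + 2) =
      charGcd n φ i * semigroupGen n φ (i + 1) +
        charGcd n φ (i + 1) * (charExp n φ (i + 2) - charExp n φ (i + 1)) := by
  rw [semigroupGen_succ (i + 1), ← charGcd_mul_charQuot (n := n) (φ := φ) i]
  push_cast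
  ring

/-- Ensures that the leading coefficient found for the cofactor does not vanish. -/
theorem semigroupGen_succ_pos (hn : 0 < n)
    (hp : ∀ d : ℕ, d ∣ n → (∀ i, PowerSeries.coeff i φ ≠ 0 → d ∣ i) → d = 1)
    {i : ℕ} (hi : charGcd n φ i ≠ 1) : 0 < semigroupGen n φ (i + 1) := by
  induction i with
  | zero =>
    rw [semigroupGen_one]
    have h1 := (charExp_succ_spec hp hi).2
    have h2 : charExp n φ 1 ≠ 0 := fun h => h1 (by rw [zero_add, h]; exact dvd_zero _)
    omega
  | succ i ih =>
    have h1 := ih (charGcd_ne_one_of_succ hi)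
    have h2 := charExp_succ_le hp hi
    have h3 : 0 < charQuot n φ (i + 1) := by
      refine Nat.pos_of_ne_zero fun h => ?_
      have := charGcd_mul_charQuot (n := n) (φ := φ) i
      rw [h, mul_zero] at this
      exact (charGcd_pos hn i).ne this
    have h4 : 0 < (charQuot n φ (i + 1) : ℤ) * semigroupGen n φ (i + 1) :=
      mul_pos (by exact_mod_cast h3) h1
    rw [semigroupGen_succ (i + 1), show i + 1 + 1 = i + 2 from rfl]
    omega

/-- The contact order of two conjugate parametrizations is a characteristic exponent. -/
theorem order_sub_rescale
    (hp : ∀ d : ℕ, d ∣ n → (∀ i, PowerSeries.coeff i φ ≠ 0 → d ∣ i) → d = 1)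
    {ζ : ℂ} (hζ : IsPrimitiveRoot ζ n) {j l : ℕ} (h1 : n ∣ j * charGcd n φ l)
    (h2 : ¬ n ∣ j * charGcd n φ (l + 1)) :
    (φ - rescale (ζ ^ j) φ).order = charExp n φ (l + 1) := by
  have hcoeff : ∀ i, PowerSeries.coeff i (φ - rescale (ζ ^ j) φ) =
      (1 - ζ ^ (j * i)) * PowerSeries.coeff i φ := by
    intro i
    rw [map_sub, PowerSeries.coeff_rescale, ← pow_mul]
    ring
  have hl : charGcd n φ l ≠ 1 := by
    intro h
    rw [charGcd_succ, h, Nat.gcd_one_left] at h2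
    exact h2 (h ▸ h1)
  refine PowerSeries.order_eq_nat.2 ⟨?_, fun i hi => ?_⟩
  · rw [hcoeff]
    -- If `ζ^{jβ} = 1` for `β = β_{l+1}`, then `n` divides both `j e_l` and `j β`, hence `j
    -- e_{l+1}`.
    refine mul_ne_zero (sub_ne_zero.2 fun h => h2 ?_) (charExp_succ_spec hp hl).1
    rw [charGcd_succ, ← Nat.gcd_mul_left]
    exact Nat.dvd_gcd h1 (hζ.pow_eq_one_iff_dvd _ |>.1 h.symm)
  · rw [hcoeff]
    by_cases h0 : PowerSeries.coeff i φ = 0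
    · rw [h0, mul_zero]
    · have h3 : n ∣ j * i := h1.trans (Nat.mul_dvd_mul_left j (charGcd_dvd_of_lt_charExp hi h0))
      rw [(hζ.pow_eq_one_iff_dvd _).2 h3, sub_self, zero_mul]

/-- The conjugate parametrizations are pairwise different. -/
theorem rescale_injOn (hn : 0 < n)
    (hp : ∀ d : ℕ, d ∣ n → (∀ i, PowerSeries.coeff i φ ≠ 0 → d ∣ i) → d = 1)
    {ζ : ℂ} (hζ : IsPrimitiveRoot ζ n) :
    Set.InjOn (fun j : ℕ => rescale (ζ ^ j) φ) (Finset.range n : Finset ℕ) := by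
  have key : ∀ i j : ℕ, i < j → j < n → rescale (ζ ^ i) φ ≠ rescale (ζ ^ j) φ := by
    intro i j hij hj h
    have h1 : ∀ k, PowerSeries.coeff k φ ≠ 0 → n ∣ (j - i) * k := by
      intro k hk
      have h2 := congrArg (PowerSeries.coeff k) h
      rw [PowerSeries.coeff_rescale, PowerSeries.coeff_rescale] at h2
      have h3 := mul_right_cancel₀ hk h2
      rw [← pow_mul, ← pow_mul, ← Nat.sub_add_cancel hij.le, add_mul, pow_add] at h3
      refine (hζ.pow_eq_one_iff_dvd _).1 ?_
      have h4 : ζ ^ (i * k) ≠ 0 := pow_ne_zero _ (hζ.ne_zero hn.ne')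
      exact mul_right_cancel₀ h4 (by rw [one_mul, ← h3])
    -- `n / gcd(n, j - i)` divides `n` and all exponents of `φ`, so it is `1` and `n ∣ j - i`,
    -- impossible for `0 < j - i < n`.
    have h5 : n / Nat.gcd n (j - i) = 1 := by
      refine hp _ (Nat.div_dvd_of_dvd (Nat.gcd_dvd_left _ _)) fun k hk => ?_
      have hg : 0 < Nat.gcd n (j - i) := Nat.gcd_pos_of_pos_left _ hn
      refine (Nat.coprime_div_gcd_div_gcd hg).dvd_of_dvd_mul_left ?_
      refine Nat.dvd_of_mul_dvd_mul_left hg ?_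
      rw [← mul_assoc, Nat.mul_div_cancel' (Nat.gcd_dvd_left _ _),
        Nat.mul_div_cancel' (Nat.gcd_dvd_right _ _)]
      exact h1 k hk
    have h6 : n = Nat.gcd n (j - i) := Nat.eq_of_dvd_of_div_eq_one (Nat.gcd_dvd_left _ _) h5 |>.symm
    have h7 : n ∣ j - i := h6 ▸ Nat.gcd_dvd_right n (j - i)
    have := Nat.le_of_dvd (by omega) h7
    omega
  intro i hi j hj h
  simp only [Finset.coe_range, Set.mem_Iio] at hi hj
  rcases lt_trichotomy i j with hij | hij | hij
  · exact absurd h (key i j hij hj)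
  · exact hij
  · exact absurd h.symm (key j i hij hi)

/-- The subgroup of `ℤ / n` annihilated by `e`, as a set of representatives. -/
def annih (n e : ℕ) : Finset ℕ := (Finset.range n).filter fun j => n ∣ j * e

theorem sum_annih {M : Type*} [AddCommMonoid M] {e q : ℕ} (he : 0 < e) (hq : 0 < q) (u : ℕ → M) :
    ∑ j ∈ annih (e * q) e, u j = ∑ i ∈ Finset.range e, u (q * i) := by
  symm
  refine Finset.sum_nbij (fun i => q * i) ?_ ?_ ?_ fun _ _ => rfl
  · intro i hi
    rw [annih, Finset.mem_filter, Finset.mem_range]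
    have := Finset.mem_range.1 hi
    exact ⟨by nlinarith, ⟨i, by ring⟩⟩
  · intro a _ b _ h
    exact Nat.eq_of_mul_eq_mul_left hq h
  · intro j hj
    rw [annih, Finset.mem_coe, Finset.mem_filter, Finset.mem_range] at hj
    obtain ⟨h1, c, hc⟩ := hj
    have h2 : j = q * c := Nat.eq_of_mul_eq_mul_right he (by rw [hc]; ring)
    refine ⟨c, ?_, h2.symm⟩
    rw [Finset.mem_coe, Finset.mem_range]
    subst h2
    by_contra h
    push Not at h
    nlinarith

/-- `annih n e` consists of the multiples of `q = n / e`. On it `j ↦ ζ^{sj}` is a nontrivial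
character when `e ∤ s`, so its values sum to zero. -/
theorem sum_annih_one_sub {n e : ℕ} (hn : 0 < n) (he : e ∣ n) {ζ : ℂ} (hζ : IsPrimitiveRoot ζ n)
    {s : ℤ} (hs : ¬ (e : ℤ) ∣ s) : ∑ j ∈ annih n e, (1 - (ζ ^ s) ^ j) = e := by
  obtain ⟨q, rfl⟩ := he
  have hepos : 0 < e := Nat.pos_of_mul_pos_right hn
  have hqpos : 0 < q := Nat.pos_of_mul_pos_left hn
  rw [sum_annih hepos hqpos, Finset.sum_sub_distrib]
  simp only [pow_mul]
  have h1 : (ζ ^ s) ^ q ≠ 1 := by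
    intro h
    rw [← zpow_natCast, ← zpow_mul, hζ.zpow_eq_one_iff_dvd] at h
    push_cast at h
    exact hs (Int.dvd_of_mul_dvd_mul_right (by exact_mod_cast hqpos.ne') h)
  have h2 : ((ζ ^ s) ^ q) ^ e = 1 := by
    rw [← pow_mul, ← zpow_natCast, ← zpow_mul, hζ.zpow_eq_one_iff_dvd]
    exact ⟨s, by push_cast; ring⟩
  have h3 := geom_sum_mul ((ζ ^ s) ^ q) e
  rw [h2, sub_self] at h3
  rw [(mul_eq_zero.1 h3).resolve_right (sub_ne_zero.2 h1)]
  simp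

/-- The weighted sum of the contact orders with the conjugate parametrizations. -/
theorem sum_one_sub_mul_order (hn : 0 < n)
    (hp : ∀ d : ℕ, d ∣ n → (∀ i, PowerSeries.coeff i φ ≠ 0 → d ∣ i) → d = 1)
    {ζ : ℂ} (hζ : IsPrimitiveRoot ζ n) {s : ℤ} {k : ℕ} (hk : ¬ (charGcd n φ k : ℤ) ∣ s)
    (hk' : (charGcd n φ (k + 1) : ℤ) ∣ s) :
    ∑ j ∈ Finset.range n, (1 - (ζ ^ s) ^ j) * ((φ - rescale (ζ ^ j) φ).order.toNat : ℂ) =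
      charGcd n φ k * semigroupGen n φ (k + 1) := by
  set T : ℕ → ℂ := fun l => ∑ j ∈ annih n (charGcd n φ l),
    (1 - (ζ ^ s) ^ j) * ((φ - rescale (ζ ^ j) φ).order.toNat : ℂ) with hT
  set χ : ℕ → ℂ := fun l => ∑ j ∈ annih n (charGcd n φ l), (1 - (ζ ^ s) ^ j) with hχ
  have hsub : ∀ l, annih n (charGcd n φ (l + 1)) ⊆ annih n (charGcd n φ l) := by
    intro l j hj
    rw [annih, Finset.mem_filter] at hj ⊢
    exact ⟨hj.1, hj.2.trans (Nat.mul_dvd_mul_left j (charGcd_succ_dvd l))⟩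
  -- On the layer between two consecutive subgroups the contact order is constantly `β_{l+1}`.
  have hstep : ∀ l, T l = T (l + 1) + charExp n φ (l + 1) * (χ l - χ (l + 1)) := by
    intro l
    simp only [hT, hχ]
    rw [← Finset.sum_sdiff (hsub l), ← Finset.sum_sdiff (hsub l) (f := fun j => 1 - (ζ ^ s) ^ j),
      add_sub_cancel_right, add_comm, Finset.mul_sum]
    congr 1
    refine Finset.sum_congr rfl fun j hj => ?_
    rw [Finset.mem_sdiff, annih, annih, Finset.mem_filter, Finset.mem_filter] at hj
    rw [order_sub_rescale hp hζ hj.1.2 fun h => hj.2 ⟨hj.1.1, h⟩, ENat.toNat_natCast, mul_comm]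
  -- Since `e_{k+1} ∣ s`, the character is trivial on this subgroup, so nothing beyond layer `k`
  -- contributes. This also covers `j = 0`, where the order is infinite.
  have hone : ∀ j ∈ annih n (charGcd n φ (k + 1)), 1 - (ζ ^ s) ^ j = 0 := by
    intro j hj
    rw [annih, Finset.mem_filter] at hj
    rw [sub_eq_zero, eq_comm, ← zpow_natCast, ← zpow_mul, hζ.zpow_eq_one_iff_dvd]
    refine (Int.natCast_dvd_natCast.2 hj.2).trans ?_
    rw [mul_comm s]
    push_cast
    exact mul_dvd_mul_left _ hk'
  have hχle : ∀ l ≤ k, χ l = charGcd n φ l := by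
    intro l hl
    refine sum_annih_one_sub hn (charGcd_dvd l) hζ fun h => hk (dvd_trans ?_ h)
    exact Int.natCast_dvd_natCast.2 (charGcd_dvd_of_le hl)
  have hTk : T k = charExp n φ (k + 1) * charGcd n φ k := by
    rw [hstep, hχle k le_rfl]
    have h1 : T (k + 1) = 0 := Finset.sum_eq_zero fun j hj => by rw [hone j hj, zero_mul]
    have h2 : χ (k + 1) = 0 := Finset.sum_eq_zero hone
    rw [h1, h2]
    ring
  -- Summation by parts over the layers; at `l = k` the last term cancels `T k`.
  have key : ∀ l ≤ k, T 0 = T l + charGcd n φ l * semigroupGen n φ (l + 1) -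
      charGcd n φ l * charExp n φ (l + 1) := by
    intro l
    induction l with
    | zero =>
      intro _
      rw [zero_add, semigroupGen_one]
      push_cast
      ring
    | succ l ih =>
      intro hl
      have h1 := congrArg (Int.cast : ℤ → ℂ) (charGcd_mul_semigroupGen (n := n) (φ := φ) l)
      push_cast at h1
      rw [ih (by omega), hstep l, hχle l (by omega), hχle (l + 1) hl, h1]
      ring
  have h0 : annih n (charGcd n φ 0) = Finset.range n :=
    Finset.filter_true_of_mem fun j _ => dvd_mul_left n j
  have h1 := key k le_rfl
  rw [hTk] at h1
  simp only [hT, h0] at h1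
  rw [h1]
  ring

end

end PlaneBranch

namespace PlaneBranch

open PowerSeries (rescale derivative)

/-! ### Lagrange interpolation at the conjugate parametrizations -/

section

variable {K : Type*} [Field K] {n : ℕ} {v : ℕ → K}

/-- Euler's identity. -/
theorem sum_eval_div_prod_eq_zero (hv : Set.InjOn v (Finset.range n : Finset ℕ))
    {P : Polynomial K} (hP : P.degree < (n - 1 : ℕ)) :
    ∑ j ∈ Finset.range n, P.eval (v j) / ∏ i ∈ (Finset.range n).erase j, (v j - v i) = 0 := by
  -- The sum is the coefficient of `Y^{n-1}` in the interpolant, which is `P` itself.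
  have h := Lagrange.coeff_eq_sum hv (P := P) (hP.trans_le (by rw [Finset.card_range]; gcongr; omega))
  rw [← h, Finset.card_range]
  exact Polynomial.coeff_eq_zero_of_degree_lt hP

/-- Write `Q = (Y - v_0) G`; then `Q'(v_0) = G(v_0)`, and Euler's identity applies to `G`. On the
right the term `j = 0` is a division by zero, hence `0`. -/
theorem eval_derivative_div_prod (hn : 0 < n) (hv : Set.InjOn v (Finset.range n : Finset ℕ))
    {Q : Polynomial K} (hQ : Q.degree < n) (h0 : Q.eval (v 0) = 0) :
    (Polynomial.derivative Q).eval (v 0) / ∏ i ∈ (Finset.range n).erase 0, (v 0 - v i) =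
      -∑ j ∈ Finset.range n,
        Q.eval (v j) / ((v j - v 0) * ∏ i ∈ (Finset.range n).erase j, (v j - v i)) := by
  obtain ⟨G, rfl⟩ := Polynomial.dvd_iff_isRoot.2 h0
  have hG : G.degree < (n - 1 : ℕ) := by
    rcases eq_or_ne G 0 with rfl | hG
    · rw [Polynomial.degree_zero]
      exact WithBot.bot_lt_coe _
    · rw [Polynomial.degree_mul, Polynomial.degree_X_sub_C, Polynomial.degree_eq_natDegree hG] at hQ
      rw [Polynomial.degree_eq_natDegree hG]
      have h1 : 1 + G.natDegree < n := by exact_mod_cast hQ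
      exact_mod_cast (by omega : G.natDegree < n - 1)
  have h1 := sum_eval_div_prod_eq_zero hv hG
  have hmem : 0 ∈ Finset.range n := Finset.mem_range.2 hn
  rw [← Finset.add_sum_erase _ _ hmem] at h1 ⊢
  simp only [Polynomial.derivative_mul, Polynomial.derivative_sub, Polynomial.derivative_X,
    Polynomial.derivative_C, Polynomial.eval_add, Polynomial.eval_mul, Polynomial.eval_sub,
    Polynomial.eval_X, Polynomial.eval_C, sub_self,
    sub_zero, one_mul, zero_mul, add_zero, zero_div, zero_add]
  rw [eq_neg_iff_add_eq_zero, ← h1]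
  congr 1
  refine Finset.sum_congr rfl fun j hj => ?_
  have h2 : v j - v 0 ≠ 0 := fun h => (Finset.mem_erase.1 hj).1
    (hv (Finset.mem_erase.1 hj).2 hmem (sub_eq_zero.1 h))
  rw [mul_div_mul_left _ _ h2]

end

/-- The logarithmic derivative of a product. -/
theorem logDeriv_prod {ι : Type*} (S : Finset ι) (u : ι → PowerSeries ℂ) (hu : ∀ i ∈ S, u i ≠ 0) :
    toLau (PowerSeries.X * derivative ℂ (∏ i ∈ S, u i)) / toLau (∏ i ∈ S, u i) =
      ∑ i ∈ S, toLau (PowerSeries.X * derivative ℂ (u i)) / toLau (u i) := by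
  classical
  induction S using Finset.induction_on with
  | empty => simp
  | insert i S hi ih =>
    rw [Finset.sum_insert hi, Finset.prod_insert hi,
      ← ih fun j hj => hu j (Finset.mem_insert_of_mem hj)]
    have h1 : toLau (u i) ≠ 0 :=
      (map_ne_zero_iff _ toLau_injective).2 (hu i (Finset.mem_insert_self i S))
    have h2 : toLau (∏ j ∈ S, u j) ≠ 0 := (map_ne_zero_iff _ toLau_injective).2
      (Finset.prod_ne_zero_iff.2 fun j hj => hu j (Finset.mem_insert_of_mem hj))
    rw [Derivation.leibniz]
    simp only [map_mul, map_add, smul_eq_mul]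
    field_simp
    ring

theorem derivative_rescale (a : ℂ) (p : PowerSeries ℂ) :
    derivative ℂ (rescale a p) = PowerSeries.C a * rescale a (derivative ℂ p) := by
  ext k
  simp only [PowerSeries.coeff_derivative, PowerSeries.coeff_rescale, PowerSeries.coeff_C_mul]
  ring

section

variable {n : ℕ} {φ : PowerSeries ℂ}

/-- Vanishing at `φ` gives vanishing at all `n` conjugates, too many roots for degree less than `n`.
-/
theorem eq_zero_of_pullback_eq_zero (hn : 0 < n) (hφ : PowerSeries.constantCoeff φ = 0)
    (hp : ∀ d : ℕ, d ∣ n → (∀ i, PowerSeries.coeff i φ ≠ 0 → d ∣ i) → d = 1)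
    {h : MvPowerSeries (Fin 2) ℂ} (hh : YDegLT n h) (h0 : pullback n φ h = 0) : h = 0 := by
  have hζ := Complex.isPrimitiveRoot_exp n hn.ne'
  refine eq_zero_of_yPoly_eq_zero hn.ne' hh
    (Polynomial.eq_zero_of_degree_lt_of_eval_index_eq_zero _ (rescale_injOn hn hp hζ) ?_ ?_)
  · rw [Finset.card_range]
    exact degree_yPoly_lt hn.ne' n h
  · intro j _
    rw [eval_rescale_yPoly hn.ne' (by rw [pow_right_comm, hζ.pow_eq_one, one_pow]),
      eval_yPoly hn.ne' hφ hh, pullbackHom_apply, h0, map_zero]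

/-- The factorization of `f(t ^ n, Y)` over `ℂ⟦t⟧`. -/
theorem yPoly_eq_nodal (hn : 0 < n) {f : Cxy} (hW : IsWeierstrass n f)
    (hφ : IsPrimitiveParam n f φ) {ζ : ℂ} (hζ : IsPrimitiveRoot ζ n) :
    yPoly hn.ne' (n + 1) (f : MvPowerSeries (Fin 2) ℂ) =
      Lagrange.nodal (Finset.range n) fun j => rescale (ζ ^ j) φ := by
  have hinj := rescale_injOn hn hφ.primitive hζ
  have hmonic := hW.monic_yPoly hn.ne'
  have hdeg := hW.degree_yPoly hn.ne'
  refine Polynomial.eq_of_degree_sub_lt_of_eval_index_eq _ hinj ?_ ?_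
  · rw [Finset.card_range, ← hdeg]
    refine Polynomial.degree_sub_lt_left ?_ hmonic.ne_zero ?_
    · rw [hdeg, Lagrange.degree_nodal, Finset.card_range]
    · rw [hmonic.leadingCoeff, (Lagrange.nodal_monic).leadingCoeff]
  · intro j hj
    rw [Lagrange.eval_nodal_at_node (v := fun j => rescale (ζ ^ j) φ) hj,
      eval_rescale_yPoly hn.ne' (by rw [pow_right_comm, hζ.pow_eq_one, one_pow]),
      eval_yPoly hn.ne' hφ.constantCoeff hW.yDegLT, pullbackHom_apply, hφ.vanishes, map_zero]

end

end PlaneBranch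

/-! ### The cofactor on the branch as a sum over conjugates -/

namespace PlaneBranch

open PowerSeries (rescale derivative)

section

variable {n : ℕ} {φ : PowerSeries ℂ}

theorem natCast_ne_zero_powerSeries (hn : n ≠ 0) : (n : PowerSeries ℂ) ≠ 0 := by
  rw [← map_natCast (PowerSeries.C : ℂ →+* PowerSeries ℂ), Ne,
    map_eq_zero_iff _ PowerSeries.C_injective]
  exact_mod_cast hn

/-- On the branch, `ω` vanishes. -/
theorem pullback_form (hn : n ≠ 0) (hφ : PowerSeries.constantCoeff φ = 0) {s : ℕ}
    {f A B M : MvPowerSeries (Fin 2) ℂ} (hf : YDegLT s f) (h0 : pullbackHom hn hφ f = 0)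
    (hV : pullbackHom hn hφ (MvPowerSeries.pderiv ℂ 1 f) ≠ 0)
    (hM : B * MvPowerSeries.pderiv ℂ 0 f + A * MvPowerSeries.pderiv ℂ 1 f = M * f) :
    (n : PowerSeries ℂ) * PowerSeries.X ^ (n - 1) * pullbackHom hn hφ A =
      pullbackHom hn hφ B * derivative ℂ φ := by
  have h1 := congrArg (pullbackHom hn hφ) hM
  simp only [map_add, map_mul, h0, mul_zero] at h1
  have h2 := derivative_pullbackHom hn hφ hf
  rw [h0, map_zero] at h2
  -- The chain rule for `f(t^n, φ) = 0` eliminates `f_x`, after which `f_y` cancels.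
  refine mul_right_cancel₀ hV ?_
  linear_combination (n : PowerSeries ℂ) * PowerSeries.X ^ (n - 1) * h1 + pullbackHom hn hφ B * h2

/-- The cofactor `M` on the branch. -/
theorem pullback_cofactor (hn : n ≠ 0) (hφ : PowerSeries.constantCoeff φ = 0) {s : ℕ}
    {f A B M : MvPowerSeries (Fin 2) ℂ} (hf : YDegLT s f) (h0 : pullbackHom hn hφ f = 0)
    (hV : pullbackHom hn hφ (MvPowerSeries.pderiv ℂ 1 f) ≠ 0)
    (hM : B * MvPowerSeries.pderiv ℂ 0 f + A * MvPowerSeries.pderiv ℂ 1 f = M * f) :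
    (n : PowerSeries ℂ) * PowerSeries.X ^ (n - 1) * pullbackHom hn hφ M *
        pullbackHom hn hφ (MvPowerSeries.pderiv ℂ 1 f) =
      pullbackHom hn hφ (MvPowerSeries.pderiv ℂ 1 f) *
        ((n : PowerSeries ℂ) * PowerSeries.X ^ (n - 1) *
            pullbackHom hn hφ (MvPowerSeries.pderiv ℂ 1 A) -
          derivative ℂ φ * pullbackHom hn hφ (MvPowerSeries.pderiv ℂ 1 B)) +
      pullbackHom hn hφ B *
        derivative ℂ (pullbackHom hn hφ (MvPowerSeries.pderiv ℂ 1 f)) := by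
  have h1 := pullback_form hn hφ hf h0 hV hM
  have h2 := derivative_pullbackHom hn hφ hf
  have h3 := derivative_pullbackHom hn hφ hf.pderiv_one
  -- The `y`-derivative of the equation, restricted to the branch. The terms in `f_xy` and `f_yy`
  -- combine to `B` times the derivative of `f_y(t^n, φ)`.
  have h4 := congrArg (fun h => pullbackHom hn hφ (MvPowerSeries.pderiv ℂ 1 h)) hM
  simp only [map_add, map_mul, Derivation.leibniz, smul_eq_mul, h0, pderiv_comm, zero_mul,
    add_zero] at h4
  rw [h0, map_zero] at h2
  rw [h3]
  linear_combination -(n : PowerSeries ℂ) * PowerSeries.X ^ (n - 1) * h4 +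
    pullbackHom hn hφ (MvPowerSeries.pderiv ℂ 1 (MvPowerSeries.pderiv ℂ 1 f)) * h1
    - pullbackHom hn hφ (MvPowerSeries.pderiv ℂ 1 B) * h2

theorem X_mul_natCast_mul_X_pow (hn : n ≠ 0) :
    (PowerSeries.X : PowerSeries ℂ) * ((n : PowerSeries ℂ) * PowerSeries.X ^ (n - 1)) =
      (n : PowerSeries ℂ) * PowerSeries.X ^ n := by
  obtain ⟨k, rfl⟩ := Nat.exists_eq_succ_of_ne_zero hn
  rw [Nat.succ_sub_one, pow_succ]
  ring

/-- The form vanishes on all conjugates of the parametrization. -/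
theorem pullback_form_conj (hn : n ≠ 0) {a : ℂ} (ha : a ^ n = 1) {p q : PowerSeries ℂ}
    (h : (n : PowerSeries ℂ) * PowerSeries.X ^ (n - 1) * p = q * derivative ℂ φ) :
    (n : PowerSeries ℂ) * PowerSeries.X ^ (n - 1) * rescale a p =
      rescale a q * derivative ℂ (rescale a φ) := by
  -- The extra factor `a` supplies `a · a^{n-1} = 1` on the left and the chain-rule factor on the
  -- right.
  have h1 := congrArg (fun u => PowerSeries.C a * rescale a u) h
  simp only [map_mul, map_pow, map_natCast, PowerSeries.rescale_X] at h1
  have h2 : (PowerSeries.C a : PowerSeries ℂ) * PowerSeries.C a ^ (n - 1) = 1 := by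
    rw [← pow_succ', Nat.sub_add_cancel (Nat.pos_of_ne_zero hn), ← map_pow, ha, map_one]
  rw [derivative_rescale]
  rw [mul_pow] at h1
  linear_combination h1 - (n : PowerSeries ℂ) * PowerSeries.X ^ (n - 1) * rescale a p * h2

/-- The expansion of `M / f_y` on the branch by partial fractions. -/
theorem cofactor_expansion (hn : 0 < n) {f A B M : Cxy} (hW : IsWeierstrass n f)
    (hφ : IsPrimitiveParam n f φ) (hA : A ∈ polysDegLT n) (hB : B ∈ polysDegLT (n - 1))
    (hM : (B : MvPowerSeries (Fin 2) ℂ) * dx f + (A : MvPowerSeries (Fin 2) ℂ) * dy f =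
      (M : MvPowerSeries (Fin 2) ℂ) * (f : MvPowerSeries (Fin 2) ℂ))
    {ζ : ℂ} (hζ : IsPrimitiveRoot ζ n) :
    pullback n φ (dy f) ≠ 0 ∧
    (n : PowerSeries ℂ) * PowerSeries.X ^ (n - 1) * pullback n φ A =
      pullback n φ B * derivative ℂ φ ∧
    ∑ j ∈ Finset.range n, toLau (rescale (ζ ^ j) (pullback n φ B)) /
      toLau (rescale (ζ ^ j) (pullback n φ (dy f))) = 0 ∧
    toLau ((n : PowerSeries ℂ) * PowerSeries.X ^ n * pullback n φ M) = toLau (pullback n φ (dy f)) *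
      ∑ j ∈ Finset.range n,
        (toLau (pullback n φ B) / toLau (pullback n φ (dy f)) -
          toLau (rescale (ζ ^ j) (pullback n φ B)) /
            toLau (rescale (ζ ^ j) (pullback n φ (dy f)))) *
        (toLau (PowerSeries.X * derivative ℂ (φ - rescale (ζ ^ j) φ)) /
          toLau (φ - rescale (ζ ^ j) φ)) := by
  have hn0 : n ≠ 0 := hn.ne'
  have hc := hφ.constantCoeff
  set π := pullbackHom hn0 hc with hπ
  have hpow : ∀ j, (ζ ^ j) ^ n = 1 := fun j => by rw [pow_right_comm, hζ.pow_eq_one, one_pow]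
  have hinj := rescale_injOn hn hφ.primitive hζ
  have hmem : 0 ∈ Finset.range n := Finset.mem_range.2 hn
  have hy0 : rescale (ζ ^ 0) φ = φ := by rw [pow_zero, PowerSeries.rescale_one]; rfl
  have hBn : YDegLT n (B : MvPowerSeries (Fin 2) ℂ) := fun m hm => hB m (by omega)
  have hF := yPoly_eq_nodal hn hW hφ hζ
  set V := π (dy f) with hVdef
  have hVj : ∀ j ∈ Finset.range n, rescale (ζ ^ j) V =
      ∏ i ∈ (Finset.range n).erase j, (rescale (ζ ^ j) φ - rescale (ζ ^ i) φ) := by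
    intro j hj
    have h1 := Lagrange.eval_nodal_derivative_eval_node_eq (v := fun j => rescale (ζ ^ j) φ) hj
    rw [← hF, eval_rescale_derivative_yPoly hn0 (hpow j), eval_derivative_yPoly hn0 hc hW.yDegLT,
      Lagrange.eval_nodal] at h1
    exact h1
  have hV0 : V = ∏ i ∈ (Finset.range n).erase 0, (φ - rescale (ζ ^ i) φ) := by
    have h1 := hVj 0 hmem
    simp only [hy0] at h1
    rwa [pow_zero, PowerSeries.rescale_one] at h1
  have hne : ∀ i ∈ (Finset.range n).erase 0, φ - rescale (ζ ^ i) φ ≠ 0 := by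
    intro i hi h
    refine (Finset.mem_erase.1 hi).1 (hinj (Finset.mem_erase.1 hi).2 hmem ?_)
    simp only [hy0]
    exact (sub_eq_zero.1 h).symm
  have hVne : V ≠ 0 := by
    rw [hV0]
    exact Finset.prod_ne_zero_iff.2 hne
  have hf0 : π f = 0 := by rw [hπ, pullbackHom_apply, hφ.vanishes]
  have hform := pullback_form hn0 hc hW.yDegLT hf0 hVne hM
  simp only [← pullbackHom_apply hn0 hc, ← hπ]
  rw [← hVdef]
  set v : ℕ → Lau := fun j => toLau (rescale (ζ ^ j) φ) with hv
  have hvinj : Set.InjOn v (Finset.range n : Finset ℕ) :=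
    fun i hi j hj h => hinj hi hj (toLau_injective h)
  have hVL : ∀ j ∈ Finset.range n, toLau (rescale (ζ ^ j) V) =
      ∏ i ∈ (Finset.range n).erase j, (v j - v i) := by
    intro j hj
    rw [hVj j hj, map_prod]
    simp only [map_sub, hv]
  refine ⟨hVne, hform, ?_, ?_⟩
  · have h1 : ((yPoly hn0 (n - 1) (B : MvPowerSeries (Fin 2) ℂ)).map toLau).degree <
        (n - 1 : ℕ) := Polynomial.degree_map_le.trans_lt (degree_yPoly_lt hn0 _ _)
    rw [← sum_eval_div_prod_eq_zero hvinj h1]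
    refine Finset.sum_congr rfl fun j hj => ?_
    rw [hVL j hj, hv, Polynomial.eval_map, Polynomial.eval₂_hom,
      eval_rescale_yPoly hn0 (hpow j), eval_yPoly hn0 hc hB]
  · set d : PowerSeries ℂ := (n : PowerSeries ℂ) * PowerSeries.X ^ (n - 1) with hd
    -- `Q(φ) = 0` by the vanishing of the form, and its `Y`-derivative at `φ` is the `A_y`, `B_y`
    -- term of the cofactor formula.
    set Q : Polynomial (PowerSeries ℂ) :=
      Polynomial.C d * yPoly hn0 n (A : MvPowerSeries (Fin 2) ℂ) -
        Polynomial.C (derivative ℂ φ) * yPoly hn0 n (B : MvPowerSeries (Fin 2) ℂ) with hQ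
    have hQdeg : (Q.map toLau).degree < n := by
      refine Polynomial.degree_map_le.trans_lt (Polynomial.degree_lt_iff_coeff_zero _ _ |>.2 ?_)
      intro j hj
      rw [hQ, Polynomial.coeff_sub, Polynomial.coeff_C_mul, Polynomial.coeff_C_mul, coeff_yPoly,
        coeff_yPoly, if_neg (by omega), if_neg (by omega), mul_zero, mul_zero, sub_zero]
    have hQj : ∀ j, Q.eval (rescale (ζ ^ j) φ) =
        rescale (ζ ^ j) (π B) * (derivative ℂ (rescale (ζ ^ j) φ) - derivative ℂ φ) := by
      intro j
      have h1 := pullback_form_conj hn0 (hpow j) hform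
      rw [hQ, Polynomial.eval_sub, Polynomial.eval_mul, Polynomial.eval_mul, Polynomial.eval_C,
        Polynomial.eval_C, eval_rescale_yPoly hn0 (hpow j), eval_rescale_yPoly hn0 (hpow j),
        eval_yPoly hn0 hc hA, eval_yPoly hn0 hc hBn]
      linear_combination h1
    have hQL : ∀ j, (Q.map toLau).eval (v j) = toLau (rescale (ζ ^ j) (π B)) *
        (toLau (derivative ℂ (rescale (ζ ^ j) φ)) - toLau (derivative ℂ φ)) := by
      intro j
      rw [hv, Polynomial.eval_map, Polynomial.eval₂_hom, hQj, map_mul, map_sub]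
    have hQ0 : (Q.map toLau).eval (v 0) = 0 := by
      rw [hQL, hy0, sub_self, mul_zero]
    have hQ' : (Polynomial.derivative (Q.map toLau)).eval (v 0) =
        toLau (d * π (MvPowerSeries.pderiv ℂ 1 A) -
          derivative ℂ φ * π (MvPowerSeries.pderiv ℂ 1 B)) := by
      rw [Polynomial.derivative_map, hv]
      simp only [hy0]
      rw [Polynomial.eval_map, Polynomial.eval₂_hom, hQ, Polynomial.derivative_sub,
        Polynomial.derivative_C_mul, Polynomial.derivative_C_mul, Polynomial.eval_sub,
        Polynomial.eval_mul, Polynomial.eval_mul, Polynomial.eval_C, Polynomial.eval_C,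
        eval_derivative_yPoly hn0 hc hA, eval_derivative_yPoly hn0 hc hBn]
    have hlag := eval_derivative_div_prod hn hvinj hQdeg hQ0
    rw [← hVL 0 hmem, hQ', pow_zero, PowerSeries.rescale_one, RingHom.id_apply] at hlag
    have hlog : toLau (PowerSeries.X * derivative ℂ V) / toLau V = ∑ j ∈ Finset.range n,
        toLau (PowerSeries.X * derivative ℂ (φ - rescale (ζ ^ j) φ)) /
          toLau (φ - rescale (ζ ^ j) φ) := by
      -- The term `j = 0` is `0 / 0 = 0`.
      rw [← Finset.add_sum_erase _ _ hmem, hy0, sub_self, map_zero toLau, div_zero, zero_add, hV0]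
      exact logDeriv_prod _ _ hne
    have hVLne : toLau V ≠ 0 := (map_ne_zero_iff _ toLau_injective).2 hVne
    have hsum : ∀ j ∈ Finset.range n, toLau PowerSeries.X * ((Q.map toLau).eval (v j) /
        ((v j - v 0) * ∏ i ∈ (Finset.range n).erase j, (v j - v i))) =
        toLau (rescale (ζ ^ j) (π B)) / toLau (rescale (ζ ^ j) V) *
          (toLau (PowerSeries.X * derivative ℂ (φ - rescale (ζ ^ j) φ)) /
            toLau (φ - rescale (ζ ^ j) φ)) := by
      intro j hj
      rw [← hVL j hj, hQL j, hv]
      simp only [hy0, map_sub, map_mul]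
      rw [← neg_sub (toLau φ), ← neg_sub (toLau (derivative ℂ φ)), div_mul_div_comm, mul_neg,
        neg_mul, neg_div_neg_eq, mul_div_assoc']
      congr 1 <;> ring
    have hcof : d * π M * V = V * (d * π (MvPowerSeries.pderiv ℂ 1 A) -
        derivative ℂ φ * π (MvPowerSeries.pderiv ℂ 1 B)) + π B * derivative ℂ V :=
      pullback_cofactor hn0 hc hW.yDegLT hf0 hVne hM
    have hmain := congrArg toLau hcof
    rw [map_mul, map_add, map_mul toLau V, map_mul toLau (π B)] at hmain
    have h1 : toLau ((n : PowerSeries ℂ) * PowerSeries.X ^ n * π M) =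
        toLau PowerSeries.X * toLau (d * π M) := by
      rw [← map_mul, hd, ← mul_assoc, X_mul_natCast_mul_X_pow hn0]
    have h2 : ∑ j ∈ Finset.range n,
        (toLau (π B) / toLau V - toLau (rescale (ζ ^ j) (π B)) / toLau (rescale (ζ ^ j) V)) *
        (toLau (PowerSeries.X * derivative ℂ (φ - rescale (ζ ^ j) φ)) /
          toLau (φ - rescale (ζ ^ j) φ)) =
        toLau (π B) / toLau V * (toLau (PowerSeries.X * derivative ℂ V) / toLau V) +
        toLau PowerSeries.X * (toLau (d * π (MvPowerSeries.pderiv ℂ 1 A) -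
          derivative ℂ φ * π (MvPowerSeries.pderiv ℂ 1 B)) / toLau V) := by
      rw [hlog, hlag, mul_neg, Finset.mul_sum, Finset.mul_sum, ← sub_eq_add_neg,
        ← Finset.sum_sub_distrib]
      refine Finset.sum_congr rfl fun j hj => ?_
      rw [hsum j hj, sub_mul]
    rw [h1, h2]
    rw [map_mul toLau PowerSeries.X]
    field_simp
    linear_combination hmain

end

end PlaneBranch
-- The leading term of the cofactor
open PlaneBranch

theorem mainTheorem9
    (n m : ℕ) (hn : 1 < n)
    (f : Cxy) (hf : Irreducible f) (hW : IsWeierstrass n f)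
    (φ : PowerSeries ℂ) (hφ : IsPrimitiveParam n f φ)
    (hm : φ.order = m) (hnm : n < m) (hdvd : ¬ n ∣ m)
    (A B M : Cxy) (hA : A ∈ polysDegLT n) (hB : B ∈ polysDegLT (n - 1))
    (hω : A ≠ 0 ∨ B ≠ 0)
    (hM : (B : MvPowerSeries (Fin 2) ℂ) * dx f + (A : MvPowerSeries (Fin 2) ℂ) * dy f =
      (M : MvPowerSeries (Fin 2) ℂ) * (f : MvPowerSeries (Fin 2) ℂ)) :
    ∃ νB νM νfy k : ℕ,
      val n φ B = νB ∧ val n φ M = νM ∧ val n φ (dy f) = νfy ∧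
      (νB : ℤ) = νM + semigroupGen n φ 0 ∧
      IsGreatest {i : ℕ | i ≤ charLength n φ ∧ ¬ (charGcd n φ i : ℤ) ∣ (νB : ℤ) - νfy} k ∧
      PowerSeries.coeff νM (pullback n φ M) =
        (charGcd n φ k : ℂ) * (semigroupGen n φ (k + 1) : ℂ) / (n : ℂ) *
          PowerSeries.coeff νB (pullback n φ B) := by
  have hn' : 0 < n := by omega
  have hζ := Complex.isPrimitiveRoot_exp n hn'.ne'
  set ζ := Complex.exp (2 * Real.pi * Complex.I / n)
  have hp := hφ.primitive
  obtain ⟨hV, hform, htrace, hexp⟩ := cofactor_expansion hn' hW hφ hA hB hM hζ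
  set V := pullback n φ (dy f) with hVdef
  set b := pullback n φ (B : MvPowerSeries (Fin 2) ℂ) with hbdef
  set p := pullback n φ (M : MvPowerSeries (Fin 2) ℂ) with hpdef
  -- If `b = 0`, then `B = 0` by its degree; the vanishing of the form then kills `A` too,
  -- contradicting `ω ≠ 0`.
  have hb : b ≠ 0 := by
    intro hb
    have hB0 : B = 0 := Subtype.ext (eq_zero_of_pullback_eq_zero hn' hφ.constantCoeff hp
      (fun m hm => hB m (by omega)) hb)
    rw [hb, zero_mul] at hform
    have hd : (n : PowerSeries ℂ) * PowerSeries.X ^ (n - 1) ≠ 0 :=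
      mul_ne_zero (natCast_ne_zero_powerSeries hn'.ne') (pow_ne_zero _ PowerSeries.X_ne_zero)
    have hA0 : A = 0 := Subtype.ext (eq_zero_of_pullback_eq_zero hn' hφ.constantCoeff hp hA
      ((mul_eq_zero.1 hform).resolve_left hd))
    exact hω.elim (fun h => h hA0) fun h => h hB0
  obtain ⟨νB, hνB⟩ := ENat.ne_top_iff_exists.1 (mt PowerSeries.order_eq_top.1 hb)
  obtain ⟨νV, hνV⟩ := ENat.ne_top_iff_exists.1 (mt PowerSeries.order_eq_top.1 hV)
  have hb0 := (PowerSeries.order_eq_nat.1 hνB.symm).1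
  have hV0 := (PowerSeries.order_eq_nat.1 hνV.symm).1
  set s : ℤ := (νB : ℤ) - νV with hs
  set c : ℂ := PowerSeries.coeff νB b / PowerSeries.coeff νV V with hc
  have hc0 : c ≠ 0 := div_ne_zero hb0 hV0
  have hζ0 : ζ ≠ 0 := hζ.ne_zero hn'.ne'
  have hlead : ∀ j, HasLead (toLau (PowerSeries.rescale (ζ ^ j) b) /
      toLau (PowerSeries.rescale (ζ ^ j) V)) s ((ζ ^ s) ^ j * c) := by
    intro j
    have h1 := (hasLead_toLau_rescale hνB.symm (ζ ^ j)).div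
      (hasLead_toLau_rescale hνV.symm (ζ ^ j))
      (mul_ne_zero (pow_ne_zero _ (pow_ne_zero _ hζ0)) hV0)
    rw [mul_div_mul_comm, ← zpow_natCast (ζ ^ j) νB, ← zpow_natCast (ζ ^ j) νV,
      ← zpow_sub₀ (pow_ne_zero _ hζ0)] at h1
    rw [hs, hc, ← zpow_natCast (ζ ^ ((νB : ℤ) - νV)), zpow_comm, zpow_natCast]
    exact h1
  -- If `n ∣ s`, all conjugates have the same leading coefficient `c`, and the zero sum `∑ b_j/V_j`
  -- would start with `n c`.
  have hns : ¬ (n : ℤ) ∣ s := by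
    intro h
    have h1 := HasLead.sum (S := Finset.range n) fun j _ => hlead j
    rw [htrace] at h1
    have h2 := h1.eq_zero
    rw [(hζ.zpow_eq_one_iff_dvd s).2 h] at h2
    simp only [one_pow, one_mul, Finset.sum_const, Finset.card_range, nsmul_eq_mul] at h2
    exact mul_ne_zero (Nat.cast_ne_zero.2 hn'.ne') hc0 h2
  set S : Set ℕ := {i : ℕ | i ≤ charLength n φ ∧ ¬ (charGcd n φ i : ℤ) ∣ s} with hS
  have hSne : S.Nonempty := ⟨0, Nat.zero_le _, hns⟩
  have hSbdd : BddAbove S := ⟨charLength n φ, fun i hi => hi.1⟩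
  have hgreat : IsGreatest S (sSup S) := ⟨Nat.sSup_mem hSne hSbdd, fun i hi => le_csSup hSbdd hi⟩
  set k := sSup S
  have hone := charGcd_charLength hn' hp
  have hklt : k < charLength n φ := by
    refine lt_of_le_of_ne hgreat.1.1 fun h => hgreat.1.2 ?_
    rw [h, hone]
    simp
  have hksucc : (charGcd n φ (k + 1) : ℤ) ∣ s := by
    by_contra h
    have := hgreat.2 (⟨hklt, h⟩ : k + 1 ∈ S)
    omega
  have hkne : charGcd n φ k ≠ 1 := fun h => hgreat.1.2 (by rw [h]; simp)
  have hsum := sum_one_sub_mul_order hn' hp hζ hgreat.1.2 hksucc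
  set σ : ℂ := charGcd n φ k * semigroupGen n φ (k + 1) with hσ
  have hσ0 : σ ≠ 0 := mul_ne_zero (Nat.cast_ne_zero.2 (charGcd_pos hn' k).ne')
    (Int.cast_ne_zero.2 (semigroupGen_succ_pos hn' hp hkne).ne')
  have hlog : ∀ j, HasLead (toLau (PowerSeries.X *
      PowerSeries.derivative ℂ (φ - PowerSeries.rescale (ζ ^ j) φ)) /
      toLau (φ - PowerSeries.rescale (ζ ^ j) φ)) 0
      ((φ - PowerSeries.rescale (ζ ^ j) φ).order.toNat : ℂ) := by
    intro j
    -- When the difference is zero, both `0 / 0` and `toNat` of the infinite order are `0`.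
    by_cases h : φ - PowerSeries.rescale (ζ ^ j) φ = 0
    · rw [h]
      exact ⟨0, by simp, by simp⟩
    · exact hasLead_logDeriv (ENat.natCast_toNat (mt PowerSeries.order_eq_top.1 h)).symm
  have htot := (hasLead_toLau hνV.symm).mul (HasLead.sum (S := Finset.range n) fun j _ =>
    ((hlead 0).sub (hlead j)).mul (hlog j))
  simp only [pow_zero, PowerSeries.rescale_one, RingHom.id_apply] at htot
  rw [← hexp] at htot
  have hcoef : PowerSeries.coeff νV V * ∑ j ∈ Finset.range n, (1 * c - (ζ ^ s) ^ j * c) *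
      ((φ - PowerSeries.rescale (ζ ^ j) φ).order.toNat : ℂ) = σ * PowerSeries.coeff νB b := by
    have h1 : PowerSeries.coeff νV V * c = PowerSeries.coeff νB b := mul_div_cancel₀ _ hV0
    rw [← h1, ← hsum, Finset.mul_sum, Finset.sum_mul]
    refine Finset.sum_congr rfl fun j _ => ?_
    ring
  -- The factor `V` turns `s` into `ν_f(B)` and `c` into the leading coefficient of `b`.
  rw [hcoef, show (νV : ℤ) + (s + 0) = νB by omega] at htot
  obtain ⟨hord, hco⟩ := htot.of_toLau (mul_ne_zero hσ0 hb0)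
  have hp0 : p ≠ 0 := by
    intro h
    rw [h, mul_zero, PowerSeries.order_zero] at hord
    exact ENat.top_ne_natCast _ hord
  obtain ⟨νM, hνM⟩ := ENat.ne_top_iff_exists.1 (mt PowerSeries.order_eq_top.1 hp0)
  have hnC : (n : PowerSeries ℂ).order = 0 := by
    rw [PowerSeries.order_zero_of_unit]
    rw [PowerSeries.isUnit_iff_constantCoeff, map_natCast]
    exact (Nat.cast_ne_zero.2 hn'.ne').isUnit
  rw [PowerSeries.order_mul, PowerSeries.order_mul, hnC, PowerSeries.order_X_pow, zero_add,
    ← hνM] at hord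
  have hνBM : νM + n = νB := by
    rw [add_comm]
    exact_mod_cast hord
  refine ⟨νB, νM, νV, k, hνB.symm, hνM.symm, hνV.symm, ?_, hgreat, ?_⟩
  · rw [← hνBM]
    push_cast
    rfl
  · have h1 : (n : PowerSeries ℂ) * PowerSeries.X ^ n * p =
        PowerSeries.X ^ n * (PowerSeries.C (n : ℂ) * p) := by
      rw [map_natCast]
      ring
    rw [h1, ← hνBM, PowerSeries.coeff_X_pow_mul, PowerSeries.coeff_C_mul, hνBM] at hco
    rw [div_mul_eq_mul_div, ← hco, mul_div_cancel_left₀ _ (Nat.cast_ne_zero.2 hn'.ne')]
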